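/- Setting. Let $(\mathcal S,\mathcal A,\mathbb P,r,\gamma,\beta)$ be an action-triggered sporadically traceable Markov decision process: $\mathcal S$ is a measurable state space, $\mathcal A$ is a finite action set with $A=|\mathcal A|$ elements, $\mathbb P(\cdot\mid s,a)$ is the transition law, $r:\mathcal S\times\mathcal A\to[0,1]$ is the reward, $\gamma\in(0,1)$ is the discount factor, and $\beta:\mathcal A\to[0,1]$ gives the probability $\beta(a)$ that executing $a$ reveals the current state. Assume that it is linear: there are $d\in\mathbb N$, a measurable feature map $\phi:\mathcal S\times\mathcal A\to\mathbb R^d$, a vector $\mu=(\mu_1,\dots,\mu_d)$ of finite signed measures on $\mathcal S$ and $\theta\in\mathbb R^d$ with $$\mathbb P(\cdot\mid s,a)=\langle\phi(s,a),\mu(\cdot)\rangle,\qquad r(s,a)=\langle\phi(s,a),\theta\rangle\qquad\text{for all }(s,a),$$ and $\sup_{s,a}\|\phi(s,a)\|_2\le 1$, $\|\theta\|_2\le\sqrt d$, $\||\mu|(\mathcal S)\|_2\le\sqrt d$, where $|\mu|(\mathcal S)$ is the vector of total variations of the $\mu_i$. The action-matrix of $a\in\mathcal A$ is $M_a=\int_{\mathcal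 S}\mu(ds)\,\phi(s,a)^{\top}\in\mathbb R^{d\times d}$. Data. Let $\mathcal D$ be a probability distribution on $\mathcal S\times\mathcal A$ whose second moment matrix $\Sigma=\mathbb E_{(s,a)\sim\mathcal D}[\phi(s,a)\phi(s,a)^{\top}]$ is positive definite, with smallest eigenvalue $\lambda_{\min}(\Sigma)$. The dataset $(s_n,a_n,s'_n,b_n)_{n=1}^N$ consists of $N$ i.i.d. samples, where $(s_n,a_n)\sim\mathcal D$ and, given $(s_n,a_n)$, the next state $s'_n\sim\mathbb P(\cdot\mid s_n,a_n)$ and the indicator $b_n\sim\mathrm{Ber}(\beta(a_n))$ are independent. For $\lambda>0$ the ridge estimator of $M_a$ is $$\widehat M_a^{\lambda}=(X^{\top}X+\lambda I_d)^{-1}X^{\top}Y_a,$$ where $X,Y_a\in\mathbb R^{N\times d}$ have rows $\phi(s_n,a_n)^{\top}$ and $\phi(s'_n,a)^{\top}$ respectively. Let $\|\cdot\|_2$ denote the $\ell_2\to\ell_2$ operator norm on matrices. Lemma. There exists an absolute constant $C\ge 1$ such that, in every such setting, for all $p\in(0,1)$ and all $N\in\mathbb N$ with $N\ge \dfrac{4C^2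 d\log(2Ad/p)}{\lambda_{\min}(\Sigma)^2}$, the ridge estimators with $\lambda=1$ satisfy $$\Pr\left(\sup_{a\in\mathcal A}\big\|\widehat M_a^{1}-M_a\big\|_2\le 4C\sqrt{\frac{d\,\log(2Ad/p)}{N\,\lambda_{\min}(\Sigma)^2}}\right)\ge 1-p .$$ -/

import Mathlib

open MeasureTheory ProbabilityTheory

universe u v w

/-- An action-triggered sporadically traceable Markov decision process `(S, A, P, r, γ, β)`:
a discounted Markov decision process with deterministic rewards in `[0, 1]`, in which executing
the action `a` reveals the state (a "data-burst") with probability `β a`. -/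
structure ATSTMDP (S : Type u) (A : Type v) [MeasurableSpace S] [MeasurableSpace A] where
  /-- The transition kernel: `P (s, a)` is the law of the next state. -/
  P : Kernel (S × A) S
  isMarkovKernel : IsMarkovKernel P
  /-- The reward function. -/
  r : S × A → ℝ
  measurable_r : Measurable r
  r_mem : ∀ x, r x ∈ Set.Icc (0 : ℝ) 1
  /-- The discount factor. -/
  γ : ℝ
  γ_mem : γ ∈ Set.Ioo (0 : ℝ) 1
  /-- The data-burst probabilities. -/
  β : A → unitInterval

namespace ATSTMDP

variable {S : Type u} {A : Type v} [MeasurableSpace S] [MeasurableSpace A] {d : ℕ}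

/-- The linear MDP condition for the feature map `φ`, the vector `μ` of `d` finite signed measures
and the reward vector `θ`: `P(· | s, a) = ⟨φ(s, a), μ(·)⟩` and `r(s, a) = ⟨φ(s, a), θ⟩`, with
`‖φ(s, a)‖₂ ≤ 1`, `‖θ‖₂ ≤ √d` and `‖|μ|(S)‖₂ ≤ √d`. -/
structure IsLinear (𝓜 : ATSTMDP S A) (φ : S × A → EuclideanSpace ℝ (Fin d))
    (μ : Fin d → SignedMeasure S) (θ : EuclideanSpace ℝ (Fin d)) : Prop where
  measurable_feature : Measurable φ
  transition_eq : ∀ (x : S × A) (B : Set S), MeasurableSet B →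
    (𝓜.P x).real B = ∑ i, φ x i * μ i B
  reward_eq : ∀ x : S × A, 𝓜.r x = inner ℝ (φ x) θ
  norm_feature_le : ∀ x, ‖φ x‖ ≤ 1
  norm_reward_le : ‖θ‖ ≤ √(d : ℝ)
  norm_variation_le :
    ‖(WithLp.toLp 2 fun i => (μ i).totalVariation.real Set.univ : EuclideanSpace ℝ (Fin d))‖
      ≤ √(d : ℝ)

/-- The kernel `(s, a) ↦ Ber(β a)` of the data-burst indicator (`true` is a data-burst). -/
noncomputable def burstKernel [Countable A] [MeasurableSingletonClass A] (𝓜 : ATSTMDP S A) :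
    Kernel (S × A) Bool :=
  (Kernel.ofFunOfCountable fun a => bernoulliMeasure true false (𝓜.β a)).comap
    Prod.snd measurable_snd

/-- The law of one off-policy data point `((s, a), (s', b))`: the pair `(s, a)` has law `D` and,
given `(s, a)`, the next state `s' ∼ P(· | s, a)` and the indicator `b ∼ Ber(β a)` are
independent. -/
noncomputable def sampleLaw [Countable A] [MeasurableSingletonClass A] (𝓜 : ATSTMDP S A)
    (D : Measure (S × A)) : Measure ((S × A) × (S × Bool)) :=
  D ⊗ₘ (𝓜.P ×ₖ 𝓜.burstKernel)

end ATSTMDP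

section ActionMatrices

variable {S : Type u} {A : Type v} [MeasurableSpace S] [MeasurableSpace A] {d N : ℕ}

/-- The action-matrix `M(a) = ∫ μ(ds) φ(s, a)ᵀ`. -/
noncomputable def actionMatrix (φ : S × A → EuclideanSpace ℝ (Fin d))
    (μ : Fin d → SignedMeasure S) (a : A) : Matrix (Fin d) (Fin d) ℝ :=
  Matrix.of fun i j => ∫ᵛ s, φ (s, a) j ∂<•(μ i)

/-- The second moment matrix `Σ = 𝔼[φ(s, a) φ(s, a)ᵀ]` for `(s, a) ∼ D`. -/
noncomputable def secondMoment (φ : S × A → EuclideanSpace ℝ (Fin d)) (D : Measure (S × A)) :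
    Matrix (Fin d) (Fin d) ℝ :=
  Matrix.of fun i j => ∫ x, φ x i * φ x j ∂D

/-- The matrix `X` with rows `φ(s_n, a_n)`. -/
def designMatrix (φ : S × A → EuclideanSpace ℝ (Fin d))
    (z : Fin N → (S × A) × (S × Bool)) : Matrix (Fin N) (Fin d) ℝ :=
  Matrix.of fun n j => φ (z n).1 j

/-- The matrix `Y_a` with rows `φ(s'_n, a)`. -/
def responseMatrix (φ : S × A → EuclideanSpace ℝ (Fin d))
    (z : Fin N → (S × A) × (S × Bool)) (a : A) : Matrix (Fin N) (Fin d) ℝ :=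
  Matrix.of fun n j => φ ((z n).2.1, a) j

/-- The ridge estimator `(XᵀX + lam • I)⁻¹ Xᵀ Y_a` computed from the dataset `z`. -/
noncomputable def ridgeEstimator (φ : S × A → EuclideanSpace ℝ (Fin d)) (lam : ℝ)
    (z : Fin N → (S × A) × (S × Bool)) (a : A) : Matrix (Fin d) (Fin d) ℝ :=
  ((designMatrix φ z).transpose * designMatrix φ z + lam • (1 : Matrix (Fin d) (Fin d) ℝ))⁻¹ *
    (designMatrix φ z).transpose * responseMatrix φ z a

end ActionMatrices

/-- The `ℓ²`-to-`ℓ²` operator norm of a square real matrix. -/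
noncomputable def l2OpNorm {d : ℕ} (M : Matrix (Fin d) (Fin d) ℝ) : ℝ :=
  ‖Matrix.toEuclideanCLM (n := Fin d) (𝕜 := ℝ) M‖

/-- The smallest eigenvalue of a square real matrix (used for symmetric matrices of size at least
one, which have a smallest eigenvalue). -/
noncomputable def minEigenvalue {d : ℕ} (M : Matrix (Fin d) (Fin d) ℝ) : ℝ :=
  sInf {t : ℝ | Module.End.HasEigenvalue (Matrix.toLin' M) t}

/-- The uniform estimation error `sup_a ‖M̂_a - M_a‖₂` (a supremum over a finite set of actions). -/
noncomputable def supOpNormError {A : Type v} {d : ℕ} (Mhat M : A → Matrix (Fin d) (Fin d) ℝ) :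
    ℝ :=
  ⨆ a : A, l2OpNorm (Mhat a - M a)

/-! The proof compares the ridge estimator with the action-matrix through the normal equations. Let
`ε_n = φ(s'_n, a) - M_aᵀ φ(s_n, a_n)` be the regression noise. Then
`(XᵀX + 1) (M̂_a - M_a) = ∑ φ(s_n, a_n) ε_nᵀ - M_a`, so it suffices to bound the smallest eigenvalue
of `XᵀX` from below and the two terms on the right from above (`l2OpNorm_ridge_sub_le`).

* The bias `M_a` has operator norm at most `√d`, because its `i`-th row integrates vectors of norm
  at most one against `μ i` (`ATSTMDP.IsLinear.l2OpNorm_actionMatrix_le`).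
* By linearity of the model, `M_aᵀ φ(s, a')` is the conditional mean of `φ(s', a)`
  (`ATSTMDP.IsLinear.nextFeature_eq_integral`). Hence the rank-one matrices `φ(s_n, a_n) ε_nᵀ` are
  i.i.d., centred, and of Frobenius norm at most `2`.
* So are the matrices `φ(s_n, a_n) φ(s_n, a_n)ᵀ - Σ`, whose sum is `XᵀX - N Σ`.

Both sums are controlled in Frobenius norm, by a dimension-free Hoeffding inequality for random
vectors in a Hilbert space (`measureReal_le_norm_sum_le`); no matrix concentration inequality is
needed. That inequality rests on `cosh ‖x + z‖ ≤ cosh ‖x‖ cosh B + (a linear function of z)` for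
`‖z‖ ≤ B` (`cosh_norm_add_le`), a consequence of the convexity of `y ↦ cosh √y`. With
`L = log (2 A d / p)`, a union bound over the `A + 1` sums shows that all of them have norm less
than `4 √(N L)` with probability at least `1 - p`. The assumption on the sample size with `C = 4`
makes this at most `N λ_min(Σ) / 2`, which keeps the smallest eigenvalue of `XᵀX` above
`N λ_min(Σ) / 2`. -/

/-! ### Hoeffding's inequality in Hilbert spaces -/

/-- The convexity of `y ↦ cosh √y`, used along the segment from `(a - b) ^ 2` to `(a + b) ^ 2`. -/
theorem Real.cosh_le_of_sq_le_add_two_mul {a b c y : ℝ} (hc : |c| ≤ 1)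
    (hy : y ^ 2 ≤ a ^ 2 + b ^ 2 + 2 * (a * b * c)) :
    Real.cosh y ≤ Real.cosh a * Real.cosh b + c * (Real.sinh a * Real.sinh b) := by
  obtain ⟨hc₁, hc₂⟩ := abs_le.mp hc
  have h₁ : (0 : ℝ) ≤ (1 + c) / 2 := by linarith
  have h₂ : (0 : ℝ) ≤ (1 - c) / 2 := by linarith
  have key : Real.cosh y ≤
      (1 + c) / 2 * Real.cosh (a + b) + (1 - c) / 2 * Real.cosh (a - b) := by
    refine hasSum_le (fun n => ?_) (Real.hasSum_cosh y)
      (((Real.hasSum_cosh (a + b)).mul_left ((1 + c) / 2)).add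
        ((Real.hasSum_cosh (a - b)).mul_left ((1 - c) / 2)))
    rw [← mul_div_assoc, ← mul_div_assoc, ← add_div, pow_mul, pow_mul, pow_mul]
    gcongr
    have hconv := (convexOn_pow (𝕜 := ℝ) n).2 (Set.mem_Ici.mpr (sq_nonneg (a + b)))
      (Set.mem_Ici.mpr (sq_nonneg (a - b))) h₁ h₂ (by ring)
    simp only [smul_eq_mul] at hconv
    refine le_trans (pow_le_pow_left₀ (sq_nonneg y) (hy.trans_eq ?_) n) hconv
    ring
  rw [Real.cosh_add, Real.cosh_sub] at key
  linarith

section Hoeffding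

theorem integrable_cosh_norm {F : Type*} [NormedAddCommGroup F] [MeasurableSpace F]
    [OpensMeasurableSpace F] {Ω : Type*} [MeasurableSpace Ω] {P : Measure Ω} [IsFiniteMeasure P]
    {X : Ω → F} (hX : Measurable X) {K : ℝ} (hK : ∀ ω, ‖X ω‖ ≤ K) :
    Integrable (fun ω => Real.cosh ‖X ω‖) P := by
  refine Integrable.of_bound (Real.continuous_cosh.measurable.comp hX.norm).aestronglyMeasurable
    (Real.cosh K) (ae_of_all _ fun ω => ?_)
  rw [Real.norm_eq_abs, abs_of_pos (Real.cosh_pos _), Real.cosh_le_cosh, abs_norm]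
  exact (hK ω).trans (le_abs_self K)

variable {E : Type*} [NormedAddCommGroup E] [InnerProductSpace ℝ E]

open scoped RealInnerProductSpace

/-- An upper bound of `cosh ‖x + z‖` on the ball `‖z‖ ≤ B` by a function affine in `z`, which makes
its expectation over a centred `z` immediate. -/
theorem cosh_norm_add_le {B : ℝ} (hB : 0 < B) (x z : E) (hz : ‖z‖ ≤ B) :
    Real.cosh ‖x + z‖ ≤ Real.cosh ‖x‖ * Real.cosh B
      + ⟪(Real.sinh ‖x‖ / ‖x‖ * (Real.sinh B / B)) • x, z⟫ := by
  rcases eq_or_ne x 0 with rfl | hx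
  · simpa [abs_of_pos hB] using hz
  have hx' : 0 < ‖x‖ := norm_pos_iff.mpr hx
  have hin : |⟪x, z⟫| ≤ ‖x‖ * B :=
    (abs_real_inner_le_norm x z).trans (by gcongr)
  -- `c` would be the cosine of the angle between `x` and `z` if `‖z‖ = B`
  have h := Real.cosh_le_of_sq_le_add_two_mul (a := ‖x‖) (b := B)
    (c := ⟪x, z⟫ / (‖x‖ * B)) (y := ‖x + z‖) ?_ ?_
  · refine h.trans_eq ?_
    rw [real_inner_smul_left]
    field_simp
  · rw [abs_div, abs_of_pos (mul_pos hx' hB)]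
    exact (div_le_one (mul_pos hx' hB)).mpr hin
  · rw [mul_div_cancel₀ _ (mul_pos hx' hB).ne', norm_add_sq_real]
    nlinarith [norm_nonneg z]

variable [MeasurableSpace E] [BorelSpace E] [SecondCountableTopology E] [CompleteSpace E]
  {Ω : Type*} [MeasurableSpace Ω] {P : Measure Ω} [IsProbabilityMeasure P]

/-- The inductive step of the exponential moment bound: an independent centred summand of norm at
most `B` multiplies the expectation of `cosh ‖·‖` by at most `cosh B`, since the first-order term
of `cosh_norm_add_le` integrates to zero. -/
theorem integral_cosh_norm_add_le {X Z : Ω → E} (hX : Measurable X) (hZ : Measurable Z)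
    (hXZ : IndepFun X Z P) {K B : ℝ} (hB : 0 < B) (hXK : ∀ ω, ‖X ω‖ ≤ K) (hZB : ∀ ω, ‖Z ω‖ ≤ B)
    (hZ0 : ∫ ω, Z ω ∂P = 0) :
    ∫ ω, Real.cosh ‖X ω + Z ω‖ ∂P ≤ (∫ ω, Real.cosh ‖X ω‖ ∂P) * Real.cosh B := by
  set G : E → E := fun x => (Real.sinh ‖x‖ / ‖x‖ * (Real.sinh B / B)) • x with hG
  have hGm : Measurable G := by
    have := Real.continuous_sinh.measurable
    rw [hG]; fun_prop
  have hGK : ∀ ω, ‖G (X ω)‖ ≤ Real.sinh K * (Real.sinh B / B) := fun ω => by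
    have hs := Real.sinh_nonneg_iff.mpr (norm_nonneg (X ω))
    have hs' := div_nonneg (Real.sinh_nonneg_iff.mpr hB.le) hB.le
    rw [hG, norm_smul, Real.norm_eq_abs, abs_of_nonneg (by positivity), mul_right_comm]
    gcongr
    rcases eq_or_ne ‖X ω‖ 0 with h0 | h0
    · simpa [h0] using (norm_nonneg _).trans (hXK ω)
    · rw [div_mul_cancel₀ _ h0]
      exact Real.sinh_le_sinh.mpr (hXK ω)
  have hint : Integrable (fun ω => ⟪G (X ω), Z ω⟫) P := by
    refine Integrable.of_bound ((hGm.comp hX).inner hZ).aestronglyMeasurable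
      (Real.sinh K * (Real.sinh B / B) * B) (ae_of_all _ fun ω => ?_)
    refine (norm_inner_le_norm _ _).trans ?_
    exact mul_le_mul (hGK ω) (hZB ω) (norm_nonneg _) ((norm_nonneg _).trans (hGK ω))
  have hzero : ∫ ω, ⟪G (X ω), Z ω⟫ ∂P = 0 := by
    have hmap := hXZ.map_prod_eq_prod_map_map hX.aemeasurable hZ.aemeasurable
    have hfm : Measurable fun q : E × E => ⟪G q.1, q.2⟫ :=
      (hGm.comp measurable_fst).inner measurable_snd
    have := Measure.isProbabilityMeasure_map (μ := P) hX.aemeasurable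
    have := Measure.isProbabilityMeasure_map (μ := P) hZ.aemeasurable
    calc ∫ ω, ⟪G (X ω), Z ω⟫ ∂P
        = ∫ q, ⟪G q.1, q.2⟫ ∂(P.map fun ω => (X ω, Z ω)) :=
          (integral_map (hX.prodMk hZ).aemeasurable hfm.aestronglyMeasurable).symm
      _ = ∫ x, ∫ z, ⟪G x, z⟫ ∂(P.map Z) ∂(P.map X) := by
          rw [hmap, integral_prod]
          rw [← hmap]
          exact (integrable_map_measure hfm.aestronglyMeasurable
            (hX.prodMk hZ).aemeasurable).mpr hint
      _ = 0 := by
          have hZi : Integrable (fun z : E => z) (P.map Z) :=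
            (integrable_map_measure measurable_id.aestronglyMeasurable hZ.aemeasurable).mpr
              (Integrable.of_bound hZ.aestronglyMeasurable B (ae_of_all _ hZB))
          have hZ0' : ∫ z, z ∂(P.map Z) = 0 := by
            exact (integral_map hZ.aemeasurable measurable_id.aestronglyMeasurable).trans hZ0
          simp [integral_inner hZi, hZ0']
  have hXi := integrable_cosh_norm (P := P) hX hXK
  calc ∫ ω, Real.cosh ‖X ω + Z ω‖ ∂P
      ≤ ∫ ω, (Real.cosh ‖X ω‖ * Real.cosh B + ⟪G (X ω), Z ω⟫) ∂P := by
        refine integral_mono (integrable_cosh_norm (hX.add hZ) (K := K + B) fun ω => ?_)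
          ((hXi.mul_const _).add hint) fun ω => cosh_norm_add_le hB _ _ (hZB ω)
        exact (norm_add_le _ _).trans (add_le_add (hXK ω) (hZB ω))
    _ = (∫ ω, Real.cosh ‖X ω‖ ∂P) * Real.cosh B := by
        rw [integral_add (hXi.mul_const _) hint, hzero, add_zero, integral_mul_const]

theorem integral_cosh_norm_sum_le {ι : Type*} {X : ι → Ω → E} (hX : ∀ i, Measurable (X i))
    (hind : iIndepFun X P) {B : ℝ} (hB : 0 < B) (hXB : ∀ i ω, ‖X i ω‖ ≤ B)
    (hX0 : ∀ i, ∫ ω, X i ω ∂P = 0) (s : Finset ι) :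
    ∫ ω, Real.cosh ‖∑ i ∈ s, X i ω‖ ∂P ≤ Real.cosh B ^ s.card := by
  classical
  induction s using Finset.induction_on with
  | empty => simp
  | insert i s hi ih =>
    have hind' : IndepFun (fun ω => ∑ j ∈ s, X j ω) (X i) P := by
      simpa [Finset.sum_fn] using hind.indepFun_finsetSum_of_notMem hX hi
    have hstep := integral_cosh_norm_add_le (Finset.measurable_sum s fun j _ => hX j) (hX i)
      hind' hB (K := s.card • B)
      (fun ω => (norm_sum_le _ _).trans (Finset.sum_le_card_nsmul _ _ _ fun j _ => hXB j ω))
      (hXB i) (hX0 i)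
    simp_rw [Finset.sum_insert hi, add_comm (X i _), Finset.card_insert_of_notMem hi, pow_succ]
    exact hstep.trans (by gcongr)

/-- **Hoeffding's inequality** for sums of independent centred bounded random vectors in a Hilbert
space (due to Pinelis); the bound does not involve the dimension. -/
theorem measureReal_le_norm_sum_le {ι : Type*} [Fintype ι] [Nonempty ι] {X : ι → Ω → E}
    (hX : ∀ i, Measurable (X i)) (hind : iIndepFun X P) {B : ℝ} (hB : 0 < B)
    (hXB : ∀ i ω, ‖X i ω‖ ≤ B) (hX0 : ∀ i, ∫ ω, X i ω ∂P = 0) {r : ℝ} (hr : 0 < r) :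
    P.real {ω | r ≤ ‖∑ i, X i ω‖} ≤ 2 * Real.exp (-(r ^ 2 / (2 * Fintype.card ι * B ^ 2))) := by
  have hn : (0 : ℝ) < Fintype.card ι := by exact_mod_cast Fintype.card_pos
  -- the optimal exponential parameter
  set t : ℝ := r / (Fintype.card ι * B ^ 2) with ht
  have ht0 : 0 < t := by positivity
  have hXm : ∀ i, Measurable fun ω => t • X i ω := fun i => (hX i).const_smul t
  have hXb : ∀ i ω, ‖t • X i ω‖ ≤ t * B := fun i ω => by
    rw [norm_smul, Real.norm_eq_abs, abs_of_pos ht0]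
    gcongr
    exact hXB i ω
  have hmom := integral_cosh_norm_sum_le (P := P) (X := fun i ω => t • X i ω) hXm
    (hind.comp (fun _ x => t • x) fun _ => measurable_const_smul t) (mul_pos ht0 hB) hXb
    (fun i => by rw [integral_smul, hX0, smul_zero]) Finset.univ
  have hnorm : ∀ ω, ‖∑ i, t • X i ω‖ = t * ‖∑ i, X i ω‖ := fun ω => by
    rw [← Finset.smul_sum, norm_smul, Real.norm_eq_abs, abs_of_pos ht0]
  have hmk := mul_meas_ge_le_integral_of_nonneg (μ := P)
    (ae_of_all _ fun ω => (Real.cosh_pos ‖∑ i, t • X i ω‖).le)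
    (integrable_cosh_norm (Finset.measurable_sum _ fun i _ => hXm i)
      (K := Finset.univ.card • (t * B)) fun ω =>
        (norm_sum_le _ _).trans (Finset.sum_le_card_nsmul _ _ _ fun i _ => hXb i ω))
    (Real.cosh (t * r))
  have hset : {ω | r ≤ ‖∑ i, X i ω‖} = {ω | Real.cosh (t * r) ≤ Real.cosh ‖∑ i, t • X i ω‖} := by
    ext ω
    rw [Set.mem_ofPred_eq, Set.mem_ofPred_eq, Real.cosh_le_cosh, hnorm,
      abs_of_pos (mul_pos ht0 hr), abs_of_nonneg (by positivity), mul_le_mul_iff_right₀ ht0]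
  rw [← hset] at hmk
  have hup : Real.cosh (t * B) ^ Fintype.card ι
      ≤ Real.exp (Fintype.card ι * ((t * B) ^ 2 / 2)) := by
    rw [Real.exp_nat_mul]
    exact pow_le_pow_left₀ (Real.cosh_pos _).le (Real.cosh_le_exp_half_sq _) _
  have hlow : Real.exp (t * r) / 2 ≤ Real.cosh (t * r) := by
    rw [Real.cosh_eq]
    linarith [Real.exp_pos (-(t * r))]
  have h := (mul_le_mul_of_nonneg_right hlow measureReal_nonneg).trans (hmk.trans (hmom.trans hup))
  have hexp : Real.exp (Fintype.card ι * ((t * B) ^ 2 / 2))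
      = Real.exp (t * r) * Real.exp (-(r ^ 2 / (2 * Fintype.card ι * B ^ 2))) := by
    rw [← Real.exp_add]
    congr 1
    rw [ht]
    field_simp
    ring
  rw [hexp] at h
  refine le_of_mul_le_mul_left ?_ (Real.exp_pos (t * r))
  linarith

end Hoeffding

/-! ### Smallest eigenvalues and ridge regression -/

section Matrices

open Matrix

variable {d N : ℕ}

theorem minEigenvalue_mul_dotProduct_le {M : Matrix (Fin d) (Fin d) ℝ} (hM : M.IsHermitian)
    (w : Fin d → ℝ) : minEigenvalue M * (w ⬝ᵥ w) ≤ w ⬝ᵥ (M *ᵥ w) := by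
  set l := minEigenvalue M with hl
  have hN : (M - l • (1 : Matrix (Fin d) (Fin d) ℝ)).IsHermitian :=
    hM.sub (isHermitian_one.smul (IsSelfAdjoint.all l))
  have hpsd : (M - l • (1 : Matrix (Fin d) (Fin d) ℝ)).PosSemidef := by
    rw [hN.posSemidef_iff_eigenvalues_nonneg]
    intro i
    -- an eigenvalue `t` of `M - l • 1` makes `t + l` an eigenvalue of `M`
    have hev : Module.End.HasEigenvalue (Matrix.toLin' M) (hN.eigenvalues i + l) := by
      refine Module.End.hasEigenvalue_of_hasEigenvector
        (x := ⇑(hN.eigenvectorBasis i)) ⟨?_, ?_⟩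
      · have h := hN.mulVec_eigenvectorBasis i
        rw [sub_mulVec, smul_mulVec, one_mulVec, sub_eq_iff_eq_add] at h
        rw [Module.End.mem_eigenspace_iff, Matrix.toLin'_apply, h, add_smul]
      · intro h0
        exact hN.eigenvectorBasis.orthonormal.ne_zero i (by ext j; exact congrFun h0 j)
    have hle := csInf_le (Module.End.finite_hasEigenvalue (Matrix.toLin' M)).bddBelow hev
    rw [minEigenvalue] at hl
    simp only [Pi.zero_apply]
    linarith
  have h := hpsd.dotProduct_mulVec_nonneg w
  rw [star_trivial, sub_mulVec, smul_mulVec, one_mulVec, dotProduct_sub, dotProduct_smul,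
    smul_eq_mul] at h
  linarith

theorem minEigenvalue_pos [NeZero d] {M : Matrix (Fin d) (Fin d) ℝ} (hM : M.PosDef) :
    0 < minEigenvalue M := by
  have hfin := Module.End.finite_hasEigenvalue (Matrix.toLin' M)
  have hne : {t : ℝ | Module.End.HasEigenvalue (Matrix.toLin' M) t}.Nonempty := by
    refine ⟨hM.1.eigenvalues 0, Module.End.hasEigenvalue_of_hasEigenvector
      (x := ⇑(hM.1.eigenvectorBasis 0)) ⟨?_, ?_⟩⟩
    · rw [Module.End.mem_eigenspace_iff, Matrix.toLin'_apply, hM.1.mulVec_eigenvectorBasis]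
    · intro h0
      exact hM.1.eigenvectorBasis.orthonormal.ne_zero 0 (by ext j; exact congrFun h0 j)
  obtain ⟨x, hx⟩ := (hne.csInf_mem hfin).exists_hasEigenvector
  have hpos := hM.dotProduct_mulVec_pos hx.2
  rw [star_trivial, ← Matrix.toLin'_apply, hx.apply_eq_smul, dotProduct_smul,
    smul_eq_mul] at hpos
  exact pos_of_mul_pos_left hpos (by simpa using dotProduct_star_self_nonneg x)

/-- The algebra behind ridge regression. With `G = XᵀX + 1`, the error `Δ` of the estimator solves
`G Δ = Xᵀ (Y - X M) - M`; testing this equation on `v` and pairing with `w = Δ v` bounds `Δ` by the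
size of the noise term `Xᵀ (Y - X M)` and of the bias `M`, relative to the smallest eigenvalue
of `XᵀX`. -/
theorem l2OpNorm_ridge_sub_le (X Y : Matrix (Fin N) (Fin d) ℝ) (M : Matrix (Fin d) (Fin d) ℝ)
    {κ ρ m : ℝ} (hκ : 0 < κ) (hρ : 0 ≤ ρ)
    (hX : ∀ w : EuclideanSpace ℝ (Fin d), κ * ‖w‖ ^ 2 ≤ (X *ᵥ ⇑w) ⬝ᵥ (X *ᵥ ⇑w))
    (hY : ∀ v w : EuclideanSpace ℝ (Fin d),
      (X *ᵥ ⇑w) ⬝ᵥ ((Y - X * M) *ᵥ ⇑v) ≤ ρ * (‖w‖ * ‖v‖))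
    (hM : l2OpNorm M ≤ m) :
    l2OpNorm ((Xᵀ * X + (1 : ℝ) • (1 : Matrix (Fin d) (Fin d) ℝ))⁻¹ * Xᵀ * Y - M)
      ≤ (ρ + m) / κ := by
  rw [one_smul]
  set G := Xᵀ * X + (1 : Matrix (Fin d) (Fin d) ℝ) with hG
  have hGpos : G.PosDef := by
    rw [hG, add_comm]
    exact PosDef.one.add_posSemidef (by simpa using posSemidef_conjTranspose_mul_self X)
  have hGdet : IsUnit G.det := (Matrix.isUnit_iff_isUnit_det _).mp hGpos.isUnit
  set R := G⁻¹ * Xᵀ * Y - M with hR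
  have hm : 0 ≤ m := (norm_nonneg _).trans hM
  have hGR : G * R = Xᵀ * (Y - X * M) - M := by
    rw [hR, Matrix.mul_sub, Matrix.mul_assoc, Matrix.mul_nonsing_inv_cancel_left _ _ hGdet, hG,
      Matrix.add_mul, Matrix.one_mul, Matrix.mul_sub, Matrix.mul_assoc, sub_sub]
  refine ContinuousLinearMap.opNorm_le_bound _ (by positivity) fun v => ?_
  set w : EuclideanSpace ℝ (Fin d) := Matrix.toEuclideanCLM (n := Fin d) (𝕜 := ℝ) R v with hw
  have hwR : (⇑w : Fin d → ℝ) = R *ᵥ ⇑v := Matrix.ofLp_toEuclideanCLM R v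
  have hnorm : ∀ x y : EuclideanSpace ℝ (Fin d), (⇑x ⬝ᵥ ⇑y : ℝ) = inner ℝ x y := fun x y => by
    rw [EuclideanSpace.inner_eq_star_dotProduct, star_trivial, dotProduct_comm]
  have hid : (X *ᵥ ⇑w) ⬝ᵥ (X *ᵥ ⇑w) + ‖w‖ ^ 2
      = (X *ᵥ ⇑w) ⬝ᵥ ((Y - X * M) *ᵥ ⇑v) - inner ℝ w (Matrix.toEuclideanCLM (𝕜 := ℝ) M v) := by
    have h := congrArg (fun H : Matrix (Fin d) (Fin d) ℝ => (⇑w : Fin d → ℝ) ⬝ᵥ (H *ᵥ ⇑v)) hGR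
    simp only at h
    rw [← Matrix.mulVec_mulVec, ← hwR, hG, add_mulVec, one_mulVec, sub_mulVec, dotProduct_add,
      dotProduct_sub, ← Matrix.mulVec_mulVec, ← Matrix.mulVec_mulVec,
      dotProduct_mulVec _ Xᵀ, dotProduct_mulVec _ Xᵀ, vecMul_transpose, hnorm w w,
      real_inner_self_eq_norm_sq] at h
    rw [h, ← hnorm w, Matrix.ofLp_toEuclideanCLM M]
  have hMv : -inner ℝ w (Matrix.toEuclideanCLM (𝕜 := ℝ) M v) ≤ m * (‖w‖ * ‖v‖) := by
    refine (neg_le_abs _).trans ((abs_real_inner_le_norm _ _).trans ?_)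
    have := (Matrix.toEuclideanCLM (n := Fin d) (𝕜 := ℝ) M).le_of_opNorm_le hM v
    calc _ ≤ ‖w‖ * (m * ‖v‖) := by gcongr
      _ = _ := by ring
  have hkey : κ * ‖w‖ ^ 2 ≤ (ρ + m) * (‖w‖ * ‖v‖) := by
    nlinarith [hX w, hY v w, sq_nonneg ‖w‖]
  rcases (norm_nonneg w).eq_or_lt with h0 | h0
  · rw [← h0]; positivity
  · rw [div_mul_eq_mul_div, le_div_iff₀ hκ]
    refine le_of_mul_le_mul_left ?_ h0
    linarith

end Matrices

/-! ### Rank-one matrices as vectors in a Euclidean space -/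

section RankOne

variable {d : ℕ}

/-- The rank-one matrix `u vᵀ`, as a vector of the Euclidean space of `d × d` matrices with the
Frobenius inner product. -/
noncomputable def outer (u v : EuclideanSpace ℝ (Fin d)) : EuclideanSpace ℝ (Fin d × Fin d) :=
  WithLp.toLp 2 fun ij => u ij.1 * v ij.2

theorem outer_apply (u v : EuclideanSpace ℝ (Fin d)) (i j : Fin d) :
    outer u v (i, j) = u i * v j := rfl

theorem inner_outer (u v u' v' : EuclideanSpace ℝ (Fin d)) :
    inner ℝ (outer u v) (outer u' v') = inner ℝ u u' * inner ℝ v v' := by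
  simp only [PiLp.inner_apply, Fintype.sum_prod_type, outer_apply, Finset.sum_mul_sum]
  refine Finset.sum_congr rfl fun i _ => Finset.sum_congr rfl fun j _ => ?_
  simp only [RCLike.inner_apply, conj_trivial]
  ring

theorem norm_outer (u v : EuclideanSpace ℝ (Fin d)) : ‖outer u v‖ = ‖u‖ * ‖v‖ := by
  rw [← sq_eq_sq₀ (norm_nonneg _) (by positivity), mul_pow]
  simp only [← real_inner_self_eq_norm_sq, inner_outer]

theorem Measurable.outer {X : Type*} [MeasurableSpace X] {f g : X → EuclideanSpace ℝ (Fin d)}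
    (hf : Measurable f) (hg : Measurable g) : Measurable fun x => outer (f x) (g x) := by
  unfold _root_.outer
  fun_prop

end RankOne

/-! ### Linear Markov decision processes -/

theorem MeasureTheory.norm_integral_le_of_norm_le_const' {X F : Type*} [MeasurableSpace X]
    [NormedAddCommGroup F] [NormedSpace ℝ F] {ν : Measure X} [IsProbabilityMeasure ν] {f : X → F}
    {K : ℝ} (hf : ∀ x, ‖f x‖ ≤ K) : ‖∫ x, f x ∂ν‖ ≤ K := by
  simpa using norm_integral_le_of_norm_le_const (μ := ν) (ae_of_all _ hf)

namespace ATSTMDP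

variable {S : Type u} {A : Type v} [MeasurableSpace S] [MeasurableSpace A] {d : ℕ}

/-- The row vector `φ(x)ᵀ M_a`, the conditional mean of the feature `φ(s', a)` given the current
state-action pair `x` (see `IsLinear.nextFeature_eq_integral`). -/
noncomputable def nextFeature (φ : S × A → EuclideanSpace ℝ (Fin d))
    (μ : Fin d → SignedMeasure S) (a : A) (x : S × A) : EuclideanSpace ℝ (Fin d) :=
  WithLp.toLp 2 fun j => ∑ i, φ x i * actionMatrix φ μ a i j

namespace IsLinear

variable {𝓜 : ATSTMDP S A} {φ : S × A → EuclideanSpace ℝ (Fin d)} {μ : Fin d → SignedMeasure S}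
  {θ : EuclideanSpace ℝ (Fin d)}

theorem abs_feature_apply_le (h : 𝓜.IsLinear φ μ θ) (x : S × A) (j : Fin d) : |φ x j| ≤ 1 :=
  (PiLp.norm_apply_le (φ x) j).trans (h.norm_feature_le x)

theorem measurable_feature_apply (h : 𝓜.IsLinear φ μ θ) (j : Fin d) :
    Measurable fun x => φ x j := by
  have := h.measurable_feature
  fun_prop

theorem measurable_feature_left (h : 𝓜.IsLinear φ μ θ) (a : A) :
    Measurable fun s => φ (s, a) :=
  h.measurable_feature.comp measurable_prodMk_right

theorem integrable_variation (h : 𝓜.IsLinear φ μ θ) (a : A) (i j : Fin d) :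
    (μ i).Integrable fun s => φ (s, a) j := by
  have : IsFiniteMeasure (μ i).variation := by
    rw [← SignedMeasure.totalVariation_eq_variation]; infer_instance
  exact Integrable.of_bound
    ((h.measurable_feature_apply j).comp measurable_prodMk_right).aestronglyMeasurable 1
    (ae_of_all _ fun s => h.abs_feature_apply_le _ j)

theorem nextFeature_eq_integral (h : 𝓜.IsLinear φ μ θ) (a : A) (x : S × A) :
    nextFeature φ μ a x = ∫ s, φ (s, a) ∂(𝓜.P x) := by
  have := 𝓜.isMarkovKernel
  have hsm : (𝓜.P x).toSignedMeasure = ∑ i, φ x i • μ i := by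
    ext B hB
    rw [Measure.toSignedMeasure_apply_measurable hB, h.transition_eq x B hB]
    simp
  ext j
  rw [eval_integral_piLp, ← VectorMeasure.integral_toSignedMeasure, hsm,
    VectorMeasure.integral_finsetSum_vectorMeasure]
  · simp [nextFeature, actionMatrix, VectorMeasure.integral_smul_vectorMeasure]
  · exact fun i _ => (h.integrable_variation a i j).smul_vectorMeasure _
  · exact fun j => Integrable.of_bound
      ((h.measurable_feature_apply j).comp measurable_prodMk_right).aestronglyMeasurable 1
      (ae_of_all _ fun s => h.abs_feature_apply_le _ j)

theorem norm_nextFeature_le (h : 𝓜.IsLinear φ μ θ) (a : A) (x : S × A) :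
    ‖nextFeature φ μ a x‖ ≤ 1 := by
  have := 𝓜.isMarkovKernel
  rw [h.nextFeature_eq_integral]
  exact norm_integral_le_of_norm_le_const' fun s => h.norm_feature_le _

theorem measurable_nextFeature (h : 𝓜.IsLinear φ μ θ) (a : A) :
    Measurable (nextFeature φ μ a) := by
  have := h.measurable_feature
  unfold nextFeature
  fun_prop

theorem actionMatrix_mulVec_apply (h : 𝓜.IsLinear φ μ θ) (a : A) (v : EuclideanSpace ℝ (Fin d))
    (i : Fin d) : (actionMatrix φ μ a).mulVec v i
      = ∫ᵛ s, inner ℝ (φ (s, a)) v ∂[(ContinuousLinearMap.lsmul ℝ ℝ (E := ℝ)).flip; μ i] := by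
  have hinner : ∀ s, inner ℝ (φ (s, a)) v = ∑ j, v j • φ (s, a) j := fun s => by
    simp [PiLp.inner_apply]
  simp only [hinner]
  have hint : ∀ j ∈ Finset.univ, (μ i).Integrable fun s => v j • φ (s, a) j := fun j _ =>
    MeasureTheory.Integrable.smul (v j) (h.integrable_variation a i j)
  rw [VectorMeasure.integral_finsetSum _ hint, Matrix.mulVec, dotProduct]
  refine Finset.sum_congr rfl fun j _ => ?_
  rw [VectorMeasure.integral_fun_smul, smul_eq_mul, mul_comm]
  rfl

theorem l2OpNorm_actionMatrix_le (h : 𝓜.IsLinear φ μ θ) (a : A) :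
    l2OpNorm (actionMatrix φ μ a) ≤ √(d : ℝ) := by
  refine ContinuousLinearMap.opNorm_le_bound _ (Real.sqrt_nonneg _) fun v => ?_
  have hfin : ∀ i, IsFiniteMeasure (μ i).variation := fun i => by
    rw [← SignedMeasure.totalVariation_eq_variation]; infer_instance
  set t : EuclideanSpace ℝ (Fin d) :=
    WithLp.toLp 2 fun i => (μ i).totalVariation.real Set.univ with ht
  have hcoord : ∀ i, ‖Matrix.toEuclideanCLM (n := Fin d) (𝕜 := ℝ) (actionMatrix φ μ a) v i‖
      ≤ ‖(‖v‖ • t) i‖ := by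
    intro i
    have hb : ∀ s, ‖inner ℝ (φ (s, a)) v‖ ≤ ‖v‖ := fun s =>
      (norm_inner_le_norm _ _).trans
        (mul_le_of_le_one_left (norm_nonneg _) (h.norm_feature_le _))
    rw [Matrix.ofLp_toEuclideanCLM, h.actionMatrix_mulVec_apply]
    refine (VectorMeasure.norm_integral_le_of_norm_le_const (ae_of_all _ hb)).trans ?_
    have hB : ‖(ContinuousLinearMap.lsmul ℝ ℝ (E := ℝ)).flip‖ ≤ 1 := by
      rw [ContinuousLinearMap.opNorm_flip]
      exact ContinuousLinearMap.opNorm_lsmul_le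
    have ht0 : 0 ≤ (μ i).totalVariation.real Set.univ := measureReal_nonneg
    rw [PiLp.smul_apply, ht, norm_smul, norm_norm, Real.norm_eq_abs, abs_of_nonneg ht0,
      SignedMeasure.totalVariation_eq_variation]
    gcongr
    exact mul_le_of_le_one_right (norm_nonneg _) hB
  calc ‖Matrix.toEuclideanCLM (n := Fin d) (𝕜 := ℝ) (actionMatrix φ μ a) v‖
      ≤ ‖‖v‖ • t‖ := by
        rw [EuclideanSpace.norm_eq, EuclideanSpace.norm_eq]
        gcongr with i
        exact hcoord i
    _ = ‖t‖ * ‖v‖ := by rw [norm_smul, norm_norm, mul_comm]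
    _ ≤ √(d : ℝ) * ‖v‖ := by gcongr; exact h.norm_variation_le

end IsLinear

/-! ### The two noise terms of the regression -/

section Noise

/-- The deviation of `φ(s, a) φ(s, a)ᵀ` from its mean `Σ`, for one data point. -/
noncomputable def designNoise (φ : S × A → EuclideanSpace ℝ (Fin d)) (D : Measure (S × A))
    (z : (S × A) × (S × Bool)) : EuclideanSpace ℝ (Fin d × Fin d) :=
  outer (φ z.1) (φ z.1) - ∫ x, outer (φ x) (φ x) ∂D

/-- The rank-one matrix `φ(s, a) (φ(s', a') - M_{a'}ᵀ φ(s, a))ᵀ` formed by the regressor and the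
regression noise of one data point, for the responses belonging to the action `a'`. -/
noncomputable def responseNoise (φ : S × A → EuclideanSpace ℝ (Fin d))
    (μ : Fin d → SignedMeasure S) (a : A) (z : (S × A) × (S × Bool)) :
    EuclideanSpace ℝ (Fin d × Fin d) :=
  outer (φ z.1) (φ (z.2.1, a) - nextFeature φ μ a z.1)

variable {𝓜 : ATSTMDP S A} {φ : S × A → EuclideanSpace ℝ (Fin d)} {μ : Fin d → SignedMeasure S}
  {θ : EuclideanSpace ℝ (Fin d)} {D : Measure (S × A)}

namespace IsLinear

theorem norm_outer_feature_le (h : 𝓜.IsLinear φ μ θ) (x : S × A) :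
    ‖outer (φ x) (φ x)‖ ≤ 1 := by
  rw [norm_outer]
  exact mul_le_one₀ (h.norm_feature_le x) (norm_nonneg _) (h.norm_feature_le x)

theorem measurable_designNoise (h : 𝓜.IsLinear φ μ θ) : Measurable (designNoise φ D) :=
  ((h.measurable_feature.outer h.measurable_feature).comp measurable_fst).sub_const _

theorem norm_designNoise_le [IsProbabilityMeasure D] (h : 𝓜.IsLinear φ μ θ)
    (z : (S × A) × (S × Bool)) : ‖designNoise φ D z‖ ≤ 2 := by
  have h₁ := h.norm_outer_feature_le z.1
  have h₂ := norm_integral_le_of_norm_le_const' (ν := D) h.norm_outer_feature_le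
  exact (norm_sub_le _ _).trans (by linarith)

theorem measurable_responseNoise (h : 𝓜.IsLinear φ μ θ) (a : A) :
    Measurable (responseNoise φ μ a) := by
  refine (h.measurable_feature.comp measurable_fst).outer (Measurable.sub ?_ ?_)
  · exact (h.measurable_feature_left a).comp (measurable_fst.comp measurable_snd)
  · exact (h.measurable_nextFeature a).comp measurable_fst

theorem norm_responseNoise_le (h : 𝓜.IsLinear φ μ θ) (a : A) (z : (S × A) × (S × Bool)) :
    ‖responseNoise φ μ a z‖ ≤ 2 := by
  have h₁ : ‖φ (z.2.1, a) - nextFeature φ μ a z.1‖ ≤ 2 :=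
    (norm_sub_le _ _).trans
      (by linarith [h.norm_feature_le (z.2.1, a), h.norm_nextFeature_le a z.1])
  rw [responseNoise, norm_outer]
  exact (mul_le_of_le_one_left (norm_nonneg _) (h.norm_feature_le _)).trans h₁

end IsLinear

variable [Countable A] [MeasurableSingletonClass A]

instance isMarkovKernel_burstKernel (𝓜 : ATSTMDP S A) : IsMarkovKernel 𝓜.burstKernel := by
  refine ⟨fun x => ?_⟩
  rw [burstKernel, Kernel.comap_apply]
  change IsProbabilityMeasure (bernoulliMeasure true false (𝓜.β x.2))
  infer_instance

instance isProbabilityMeasure_sampleLaw (𝓜 : ATSTMDP S A) (D : Measure (S × A))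
    [IsProbabilityMeasure D] : IsProbabilityMeasure (𝓜.sampleLaw D) := by
  have := 𝓜.isMarkovKernel
  rw [sampleLaw]
  infer_instance

namespace IsLinear

theorem integral_designNoise [IsProbabilityMeasure D] (h : 𝓜.IsLinear φ μ θ) :
    ∫ z, designNoise φ D z ∂(𝓜.sampleLaw D) = 0 := by
  have := 𝓜.isMarkovKernel
  have hm := h.measurable_feature.outer h.measurable_feature
  have hi : Integrable (fun z : (S × A) × (S × Bool) => outer (φ z.1) (φ z.1))
      (𝓜.sampleLaw D) :=
    Integrable.of_bound (hm.comp measurable_fst).aestronglyMeasurable 1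
      (ae_of_all _ fun z => h.norm_outer_feature_le z.1)
  have hfst : (𝓜.sampleLaw D).map Prod.fst = D := by
    rw [sampleLaw]
    exact Measure.fst_compProd D _
  have heq : ∫ z : (S × A) × (S × Bool), outer (φ z.1) (φ z.1) ∂(𝓜.sampleLaw D)
      = ∫ x, outer (φ x) (φ x) ∂D := by
    conv_rhs => rw [← hfst]
    exact (integral_map measurable_fst.aemeasurable hm.aestronglyMeasurable).symm
  simp only [designNoise]
  rw [integral_sub hi (integrable_const _), heq]
  simp

/-- The regression noise has conditional mean zero given the current state-action pair. -/
theorem integral_responseNoise [IsProbabilityMeasure D] (h : 𝓜.IsLinear φ μ θ) (a : A) :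
    ∫ z, responseNoise φ μ a z ∂(𝓜.sampleLaw D) = 0 := by
  have := 𝓜.isMarkovKernel
  have hint : ∀ ν : Measure ((S × A) × (S × Bool)), IsProbabilityMeasure ν →
      Integrable (responseNoise φ μ a) ν := fun ν _ =>
    Integrable.of_bound (h.measurable_responseNoise a).aestronglyMeasurable 2
      (ae_of_all _ (h.norm_responseNoise_le a))
  have hi := hint (𝓜.sampleLaw D) inferInstance
  rw [sampleLaw] at hi ⊢
  rw [Measure.integral_compProd hi]
  refine integral_eq_zero_of_ae (ae_of_all _ fun x => ?_)
  have hfi : Integrable (fun s => φ (s, a)) (𝓜.P x) :=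
    Integrable.of_bound (h.measurable_feature_left a).aestronglyMeasurable 1
      (ae_of_all _ fun s => h.norm_feature_le _)
  have hmean : ∫ s, (φ (s, a) - nextFeature φ μ a x) ∂(𝓜.P x) = 0 := by
    rw [integral_sub hfi (integrable_const _), ← h.nextFeature_eq_integral]
    simp
  have hdi : Integrable (fun s => φ (s, a) - nextFeature φ μ a x) (𝓜.P x) :=
    hfi.sub (integrable_const _)
  have hbound : ∀ s, ‖outer (φ x) (φ (s, a) - nextFeature φ μ a x)‖ ≤ 2 := fun s =>
    h.norm_responseNoise_le a (x, (s, true))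
  have hoi : Integrable (fun s => outer (φ x) (φ (s, a) - nextFeature φ μ a x)) (𝓜.P x) :=
    Integrable.of_bound (Measurable.outer measurable_const
      ((h.measurable_feature_left a).sub_const _)).aestronglyMeasurable 2 (ae_of_all _ hbound)
  change ∫ q : S × Bool, outer (φ x) (φ (q.1, a) - nextFeature φ μ a x)
    ∂((𝓜.P ×ₖ 𝓜.burstKernel) x) = 0
  rw [Kernel.prod_apply, integral_fun_fst
    (fun s => outer (φ x) (φ (s, a) - nextFeature φ μ a x))]
  ext ⟨i, j⟩
  rw [probReal_univ, one_smul, eval_integral_piLp fun ij => hoi.eval_piLp ij]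
  simp only [outer_apply]
  rw [integral_const_mul, ← eval_integral_piLp fun j => hdi.eval_piLp j, hmean]
  simp

end IsLinear

end Noise

end ATSTMDP

/-! ### The estimation error in terms of the noise -/

open Matrix in
theorem designMatrix_mulVec_apply {S : Type u} {A : Type v} {d N : ℕ}
    {φ : S × A → EuclideanSpace ℝ (Fin d)} (z : Fin N → (S × A) × (S × Bool))
    (w : EuclideanSpace ℝ (Fin d)) (n : Fin N) :
    (designMatrix φ z *ᵥ ⇑w) n = inner ℝ (φ (z n).1) w := by
  simp [designMatrix, mulVec, dotProduct, PiLp.inner_apply, mul_comm]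

open Matrix in
theorem response_bilinForm {S : Type u} {A : Type v} [MeasurableSpace S] {d N : ℕ}
    {φ : S × A → EuclideanSpace ℝ (Fin d)} {μ : Fin d → SignedMeasure S}
    (z : Fin N → (S × A) × (S × Bool)) (a : A) (v w : EuclideanSpace ℝ (Fin d)) :
    (designMatrix φ z *ᵥ ⇑w)
        ⬝ᵥ ((responseMatrix φ z a - designMatrix φ z * actionMatrix φ μ a) *ᵥ ⇑v)
      = inner ℝ (∑ n, ATSTMDP.responseNoise φ μ a (z n)) (outer w v) := by
  rw [sum_inner, dotProduct]
  refine Finset.sum_congr rfl fun n _ => ?_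
  rw [ATSTMDP.responseNoise, inner_outer, designMatrix_mulVec_apply]
  congr 1
  simp [mulVec, dotProduct, PiLp.inner_apply, responseMatrix, designMatrix, ATSTMDP.nextFeature,
    Matrix.mul_apply, mul_comm]

namespace ATSTMDP

namespace IsLinear

variable {S : Type u} {A : Type v} [MeasurableSpace S] [MeasurableSpace A] {d N : ℕ}
  {𝓜 : ATSTMDP S A} {φ : S × A → EuclideanSpace ℝ (Fin d)} {μ : Fin d → SignedMeasure S}
  {θ : EuclideanSpace ℝ (Fin d)} {D : Measure (S × A)}

open Matrix

/-- In dimension zero every transition probability would vanish. -/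
theorem dim_pos (h : 𝓜.IsLinear φ μ θ) (x : S × A) : 0 < d := by
  have := 𝓜.isMarkovKernel
  refine Nat.pos_of_ne_zero ?_
  rintro rfl
  have := h.transition_eq x Set.univ MeasurableSet.univ
  simp at this

theorem designMatrix_quadForm [IsProbabilityMeasure D] (h : 𝓜.IsLinear φ μ θ)
    (z : Fin N → (S × A) × (S × Bool)) (w : EuclideanSpace ℝ (Fin d)) :
    (designMatrix φ z *ᵥ ⇑w) ⬝ᵥ (designMatrix φ z *ᵥ ⇑w)
      = inner ℝ (∑ n, designNoise φ D (z n)) (outer w w)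
        + N * (⇑w ⬝ᵥ (secondMoment φ D *ᵥ ⇑w)) := by
  have hi : Integrable (fun x => outer (φ x) (φ x)) D :=
    Integrable.of_bound
      (h.measurable_feature.outer h.measurable_feature).aestronglyMeasurable 1
      (ae_of_all _ h.norm_outer_feature_le)
  have hmean : inner ℝ (∫ x, outer (φ x) (φ x) ∂D) (outer w w)
      = ⇑w ⬝ᵥ (secondMoment φ D *ᵥ ⇑w) := by
    rw [PiLp.inner_apply, Fintype.sum_prod_type, dotProduct]
    refine Finset.sum_congr rfl fun i _ => ?_
    rw [mulVec, dotProduct, Finset.mul_sum]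
    refine Finset.sum_congr rfl fun j _ => ?_
    rw [eval_integral_piLp fun ij => hi.eval_piLp ij]
    simp only [outer_apply, secondMoment, of_apply, RCLike.inner_apply, conj_trivial]
    ring
  simp only [dotProduct, designMatrix_mulVec_apply, designNoise] at *
  rw [sum_inner]
  simp only [inner_sub_left, inner_outer, hmean, Finset.sum_sub_distrib, Finset.sum_const,
    Finset.card_univ, Fintype.card_fin, nsmul_eq_mul]
  ring

/-- On the event that all noise sums have norm at most `r`, the ridge estimator is accurate: the
first sum keeps `XᵀX` above `N λ_min(Σ) - r ≥ N λ_min(Σ) / 2`, and the bias due to the ridge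
penalty is at most `‖M_a‖ ≤ √d`. -/
theorem l2OpNorm_ridgeEstimator_sub_le [IsProbabilityMeasure D] (h : 𝓜.IsLinear φ μ θ)
    (hS : (secondMoment φ D).IsHermitian) (z : Fin N → (S × A) × (S × Bool)) (a : A) {r : ℝ}
    (hpos : 0 < N * minEigenvalue (secondMoment φ D))
    (hr : r ≤ N * minEigenvalue (secondMoment φ D) / 2)
    (h₁ : ‖∑ n, designNoise φ D (z n)‖ ≤ r) (h₂ : ‖∑ n, responseNoise φ μ a (z n)‖ ≤ r) :
    l2OpNorm (ridgeEstimator φ 1 z a - actionMatrix φ μ a)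
      ≤ (r + √(d : ℝ)) / (N * minEigenvalue (secondMoment φ D) / 2) := by
  refine l2OpNorm_ridge_sub_le _ _ _ (by positivity) ((norm_nonneg _).trans h₁) (fun w => ?_)
    (fun v w => ?_) (h.l2OpNorm_actionMatrix_le a)
  · rw [h.designMatrix_quadForm (D := D)]
    have hin := neg_le_of_abs_le
      (abs_real_inner_le_norm (∑ n, designNoise φ D (z n)) (outer w w))
    rw [norm_outer] at hin
    have hmul : ‖∑ n, designNoise φ D (z n)‖ * (‖w‖ * ‖w‖)
        ≤ N * minEigenvalue (secondMoment φ D) / 2 * (‖w‖ * ‖w‖) := by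
      gcongr
      exact h₁.trans hr
    have hev := mul_le_mul_of_nonneg_left (minEigenvalue_mul_dotProduct_le hS w)
      (Nat.cast_nonneg (α := ℝ) N)
    have hww : (⇑w ⬝ᵥ ⇑w : ℝ) = ‖w‖ * ‖w‖ := by
      rw [← real_inner_self_eq_norm_mul_norm, EuclideanSpace.inner_eq_star_dotProduct,
        star_trivial]
    rw [hww] at hev
    nlinarith
  · rw [response_bilinForm, ← norm_outer]
    exact (real_inner_le_norm _ _).trans (by gcongr)

end IsLinear

end ATSTMDP

/-! ### Concentration of the noise sums -/

section Concentration

variable {Ω : Type*} [MeasurableSpace Ω] {P : Measure Ω} [IsProbabilityMeasure P]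

theorem one_sub_le_measureReal_of_compl_subset {s t : Set Ω} {p : ℝ} (hst : sᶜ ⊆ t)
    (ht : P.real t ≤ p) : 1 - p ≤ P.real s := by
  have h := measureReal_union_le (μ := P) s sᶜ
  rw [Set.union_compl_self, probReal_univ] at h
  linarith [measureReal_mono (μ := P) hst]

/-- Hoeffding's inequality at the radius `4 √(N L)`, for a function of the data points. The square
in the bound leaves room for a union bound over all actions. -/
theorem measureReal_le_norm_sum_comp_le {E Z : Type*} [NormedAddCommGroup E]
    [InnerProductSpace ℝ E] [MeasurableSpace E] [BorelSpace E] [SecondCountableTopology E]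
    [CompleteSpace E] [MeasurableSpace Z] {Q : Measure Z} {N : ℕ} [NeZero N]
    {data : Fin N → Ω → Z} (hdata : ∀ n, Measurable (data n)) (hind : iIndepFun data P)
    (hlaw : ∀ n, P.map (data n) = Q) {f : Z → E} (hf : Measurable f) (hf2 : ∀ z, ‖f z‖ ≤ 2)
    (hf0 : ∫ z, f z ∂Q = 0) {L : ℝ} (hL : 0 < L) :
    P.real {ω | 4 * √(N * L) ≤ ‖∑ n, f (data n ω)‖} ≤ 2 * Real.exp (-L) ^ 2 := by
  have hN : (0 : ℝ) < N := by exact_mod_cast NeZero.pos N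
  have h := measureReal_le_norm_sum_le (P := P) (X := fun n ω => f (data n ω))
    (fun n => hf.comp (hdata n)) (hind.comp (fun _ => f) fun _ => hf) two_pos
    (fun n ω => hf2 _)
    (fun n => by rw [← hf0, ← hlaw n, integral_map (hdata n).aemeasurable hf.aestronglyMeasurable])
    (r := 4 * √(N * L)) (by positivity)
  refine h.trans_eq ?_
  rw [← Real.exp_nat_mul, mul_pow, Real.sq_sqrt (by positivity), Fintype.card_fin]
  congr 2
  push_cast
  field_simp
  ring

end Concentration

/-! ### The choice of constants -/

/-- The assumption on the sample size with `C = 4` bounds the radius `4 √(N L)` of the noise sums by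
half of the smallest eigenvalue `N l` of `N Σ`. -/
theorem four_mul_sqrt_le_half_mul {N d l L : ℝ} (hN : 0 < N) (hl : 0 < l) (hd : 1 ≤ d)
    (hL : 0 < L) (h : 4 * 4 ^ 2 * d * L / l ^ 2 ≤ N) : 4 * √(N * L) ≤ N * l / 2 := by
  rw [div_le_iff₀ (by positivity)] at h
  have h64 : 64 * L ≤ N * l ^ 2 := by nlinarith
  have hs : √(N * L) ≤ N * l / 8 := by
    rw [Real.sqrt_le_left (by positivity)]
    nlinarith
  linarith

theorem add_sqrt_div_le {N d l L : ℝ} (hN : 1 ≤ N) (hl : 0 < l) (hd : 1 ≤ d) (hL : 1 / 4 ≤ L) :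
    (4 * √(N * L) + √d) / (N * l / 2) ≤ 4 * 4 * √(d * L / (N * l ^ 2)) := by
  have h₀ : √(d * L / (N * l ^ 2)) = √(N * (d * L)) / (N * l) := by
    rw [← Real.sqrt_sq (show 0 ≤ N * l by positivity), ← Real.sqrt_div' _ (by positivity)]
    congr 1
    field_simp
  have h₁ : √(N * L) ≤ √(N * (d * L)) := Real.sqrt_le_sqrt (by
    have : L ≤ d * L := le_mul_of_one_le_left (by linarith) hd
    gcongr)
  have h₂ : √d ≤ 2 * √(N * (d * L)) := by
    rw [Real.sqrt_le_left (by positivity), mul_pow, Real.sq_sqrt (by positivity)]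
    have : d * L ≤ N * (d * L) := le_mul_of_one_le_left (by positivity) hN
    nlinarith
  rw [h₀, div_le_iff₀ (by positivity)]
  calc 4 * √(N * L) + √d ≤ 8 * √(N * (d * L)) := by
        linarith [Real.sqrt_nonneg (N * (d * L))]
    _ = _ := by field_simp; ring

theorem union_bound_le {k d p : ℝ} (hk : 1 ≤ k) (hd : 1 ≤ d) (hp : 0 < p) (hp1 : p < 1) :
    (k + 1) * (2 * Real.exp (-Real.log (2 * k * d / p)) ^ 2) ≤ p := by
  rw [Real.exp_neg, Real.exp_log (by positivity), inv_div, div_pow, ← mul_div_assoc,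
    ← mul_div_assoc, div_le_iff₀ (by positivity)]
  have hk' : (k + 1) * (2 * p ^ 2) ≤ (2 * k) * (2 * p ^ 2) := by gcongr; linarith
  have hp' : p ^ 2 ≤ p := by nlinarith
  have hkd : 1 ≤ k * d ^ 2 := one_le_mul_of_one_le_of_one_le hk (one_le_pow₀ hd)
  calc (k + 1) * (2 * p ^ 2) ≤ 4 * k * p ^ 2 := by linarith
    _ ≤ 4 * k * p := by gcongr
    _ ≤ 4 * k * p * (k * d ^ 2) := le_mul_of_one_le_right (by positivity) hkd
    _ = p * (2 * k * d) ^ 2 := by ring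

theorem mainTheorem5 :
    ∃ C : ℝ, 1 ≤ C ∧
      ∀ (S : Type u) (A : Type v) [MeasurableSpace S] [MeasurableSpace A]
        [Fintype A] [MeasurableSingletonClass A] (d : ℕ)
        (𝓜 : ATSTMDP S A) (φ : S × A → EuclideanSpace ℝ (Fin d))
        (μ : Fin d → SignedMeasure S) (θ : EuclideanSpace ℝ (Fin d))
        (_ : 𝓜.IsLinear φ μ θ)
        (D : Measure (S × A)) [IsProbabilityMeasure D] (_ : (secondMoment φ D).PosDef)
        (Ω : Type w) [MeasurableSpace Ω] (Pr : Measure Ω) [IsProbabilityMeasure Pr] (N : ℕ)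
        (data : Fin N → Ω → (S × A) × (S × Bool))
        (_ : ∀ n, Measurable (data n))
        (_ : iIndepFun data Pr)
        (_ : ∀ n, Pr.map (data n) = 𝓜.sampleLaw D)
        (p : ℝ) (_ : p ∈ Set.Ioo (0 : ℝ) 1)
        (_ : 4 * C ^ 2 * d * Real.log (2 * Fintype.card A * d / p)
              / minEigenvalue (secondMoment φ D) ^ 2 ≤ (N : ℝ)),
        1 - p ≤ Pr.real {ω |
          supOpNormError (ridgeEstimator φ 1 (fun n => data n ω)) (actionMatrix φ μ)
            ≤ 4 * C * √(d * Real.log (2 * Fintype.card A * d / p)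
                / (N * minEigenvalue (secondMoment φ D) ^ 2))} := by
  refine ⟨4, by norm_num, ?_⟩
  intro S A _ _ _ _ d 𝓜 φ μ θ h D _ hS Ω _ Pr _ N data hdata hind hlaw p ⟨hp0, hp1⟩ hN
  obtain ⟨x⟩ := nonempty_of_isProbabilityMeasure D
  have : Nonempty A := ⟨x.2⟩
  have hdpos := h.dim_pos x
  have : NeZero d := ⟨hdpos.ne'⟩
  have hd : (1 : ℝ) ≤ d := by exact_mod_cast hdpos
  have hk : (1 : ℝ) ≤ Fintype.card A := by exact_mod_cast Fintype.card_pos (α := A)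
  have hl := minEigenvalue_pos hS
  set l := minEigenvalue (secondMoment φ D) with hl_def
  set L := Real.log (2 * Fintype.card A * d / p) with hL_def
  have hL : 1 / 4 ≤ L := by
    have h2 : (2 : ℝ) ≤ 2 * Fintype.card A * d / p := by
      rw [le_div_iff₀ hp0]
      nlinarith [mul_le_mul hk hd zero_le_one (zero_le_one.trans hk)]
    linarith [Real.log_two_gt_d9, Real.log_le_log two_pos h2]
  have hL0 : 0 < L := by linarith
  -- the lower bound on the sample size is positive, so the sample is not empty
  have hNpos : (0 : ℝ) < N := lt_of_lt_of_le (by positivity) hN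
  have : NeZero N := ⟨by rintro rfl; simp at hNpos⟩
  have hN1 : (1 : ℝ) ≤ N := by exact_mod_cast NeZero.pos N
  -- the centred matrices to be summed: `none` stands for the design, `some a` for the responses
  let f : Option A → (S × A) × (S × Bool) → EuclideanSpace ℝ (Fin d × Fin d) := fun o =>
    o.elim (ATSTMDP.designNoise φ D) (ATSTMDP.responseNoise φ μ)
  have htail : ∀ o, Pr.real {ω | 4 * √(N * L) ≤ ‖∑ n, f o (data n ω)‖}
      ≤ 2 * Real.exp (-L) ^ 2 := by
    rintro (_ | a)
    · exact measureReal_le_norm_sum_comp_le hdata hind hlaw h.measurable_designNoise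
        h.norm_designNoise_le h.integral_designNoise hL0
    · exact measureReal_le_norm_sum_comp_le hdata hind hlaw (h.measurable_responseNoise a)
        (h.norm_responseNoise_le a) (h.integral_responseNoise a) hL0
  refine one_sub_le_measureReal_of_compl_subset
    (t := ⋃ o, {ω | 4 * √(N * L) ≤ ‖∑ n, f o (data n ω)‖}) ?_ ?_
  -- outside the union of the bad events the deterministic error bound applies
  · rw [Set.compl_subset_comm]
    intro ω hω
    simp only [Set.mem_compl_iff, Set.mem_iUnion, Set.mem_ofPred_eq, not_exists, not_le] at hω
    change supOpNormError _ _ ≤ _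
    rw [supOpNormError]
    refine ciSup_le fun a => ?_
    exact (h.l2OpNorm_ridgeEstimator_sub_le hS.1 _ a (by positivity)
      (four_mul_sqrt_le_half_mul hNpos hl hd hL0 hN) (hω none).le (hω (some a)).le).trans
      (add_sqrt_div_le hN1 hl hd hL)
  · refine (measureReal_iUnion_fintype_le _).trans ((Finset.sum_le_sum fun o _ => htail o).trans ?_)
    rw [Finset.sum_const, Finset.card_univ, Fintype.card_option, nsmul_eq_mul]
    push_cast
    exact union_bound_le hk hd hp0 hp1
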